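/- Let $n \ge 1$, let $a, b > 0$ and $\eta \in \mathbb{R}$, and let $f : \mathbb{R}^n \times [0,\infty) \to \mathbb{R}$ be a positive classical solution of the Newell-Whitehead equation $$f_t = \Delta f + a f - b f^3,$$ that is, $f>0$ everywhere, $f$ is continuous on $\mathbb{R}^n\times[0,\infty)$, $f(\cdot,t)$ is $C^2$ on $\mathbb{R}^n$ for every $t>0$, and at every $(x,t)$ with $t>0$ the time derivative exists and the equation holds. Suppose that $f$ is a traveling wave with wave speed $\eta$, i.e. that there is a function $v : \mathbb{R}^n \to \mathbb{R}$ with $$f(x,t) = v(x_1, \dots, x_{n-1}, x_n + \eta t) \qquad \text{for all } x \in \mathbb{R}^n,\ t \ge 0,$$ and that there is a sequence $(z_k)$ in $\mathbb{R}^n$ with $|z_k| \to \infty$ and $v(z_k) \to 0$. Then $$\eta^2 \ge \tfrac{4}{3}\, a.$$ -/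

import Mathlib

open Filter Topology

/-- `f : ℝⁿ × [0, ∞) → ℝ` (written in curried form; only the values at times `t ≥ 0` matter) is a
classical solution of the Newell-Whitehead equation `f_t = Δ f + a f - b f³`. Here `Δ` is the
Laplacian in the space variable. -/
structure IsNewellWhiteheadSolution {n : ℕ} (a b : ℝ)
    (f : EuclideanSpace ℝ (Fin n) → ℝ → ℝ) : Prop where
  continuousOn : ContinuousOn (fun p : EuclideanSpace ℝ (Fin n) × ℝ => f p.1 p.2)
    (Set.univ ×ˢ Set.Ici 0)
  contDiff_space : ∀ t : ℝ, 0 < t → ContDiff ℝ 2 (fun x => f x t)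
  equation : ∀ (x : EuclideanSpace ℝ (Fin n)) (t : ℝ), 0 < t →
    HasDerivAt (fun s => f x s)
      (Laplacian.laplacian (fun y => f y t) x + a * f x t - b * f x t ^ 3) t

/-- The last index of `Fin n`, for `n ≥ 1`. -/
def lastIndex (n : ℕ) (hn : 1 ≤ n) : Fin n := ⟨n - 1, by omega⟩

/-- `f` has the travelling wave form `f(x, t) = v(x₁, …, x_{n-1}, x_n + η t)` for `x ∈ ℝⁿ`,
`t ≥ 0`. -/
def HasTravelingWaveForm {n : ℕ} (hn : 1 ≤ n) (η : ℝ) (v : EuclideanSpace ℝ (Fin n) → ℝ)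
    (f : EuclideanSpace ℝ (Fin n) → ℝ → ℝ) : Prop :=
  ∀ (x : EuclideanSpace ℝ (Fin n)) (t : ℝ), 0 ≤ t →
    f x t = v (x + EuclideanSpace.single (lastIndex n hn) (η * t))

/-! The profile satisfies `Δ v - η ∂ₘ v + a v - b v³ = 0`. The factor `exp (η yₘ / 2)` removes the
drift and turns `a` into `a - η² / 4`. If this is positive, a bump on a large enough ball is a
strict subsolution of the linear part. Scale `v` until it touches the bump from above: at the
contact point the cubic term must compensate, so `v` is not small there, and the touching factor
carries this bound to the centre of the ball. The centre is arbitrary, so `v` has a positive lower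
bound (`exists_pos_le_of_speed_lt`) and cannot tend to `0` along any sequence. -/

/-- The second-order necessary condition for a local minimum on the line. -/
theorem nonneg_second_deriv_of_isLocalMin {g g' : ℝ → ℝ} {c x : ℝ} (hmin : IsLocalMin g x)
    (hg : ∀ t, HasDerivAt g (g' t) t) (hg' : HasDerivAt g' c x) : 0 ≤ c := by
  have hd : deriv g = g' := funext fun t => (hg t).deriv
  by_contra! hc
  -- If `c < 0`, then `x` is also a local maximum, so `g` is locally constant and `c = 0`.
  have hmax : IsLocalMax g x := isLocalMax_of_deriv_deriv_neg (by rw [hd, hg'.deriv]; exact hc)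
    (hmin.deriv_eq_zero) (hg x).continuousAt
  have hconst : g =ᶠ[𝓝 x] fun _ => g x := by
    filter_upwards [hmin, hmax] with t h1 h2 using le_antisymm h2 h1
  have hzero : g' =ᶠ[𝓝 x] fun _ => 0 := by
    have := hconst.deriv
    rw [hd] at this
    simpa using this
  have := hzero.deriv_eq
  rw [hg'.deriv] at this
  simp at this
  exact hc.ne this

section Line

variable {E : Type*} [NormedAddCommGroup E] [NormedSpace ℝ E] {u : E → ℝ}

theorem hasDerivAt_comp_line (hu : ContDiff ℝ 2 u) (x e : E) (t : ℝ) :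
    HasDerivAt (fun t : ℝ => u (x + t • e)) (fderiv ℝ u (x + t • e) e) t := by
  have hl : HasDerivAt (fun t : ℝ => x + t • e) e t := by
    simpa using ((hasDerivAt_id t).smul_const e).const_add x
  exact ((hu.differentiable (by norm_num)) _).hasFDerivAt.comp_hasDerivAt t hl

theorem hasDerivAt_fderiv_comp_line (hu : ContDiff ℝ 2 u) (x e : E) :
    HasDerivAt (fun t : ℝ => fderiv ℝ u (x + t • e) e) (iteratedFDeriv ℝ 2 u x ![e, e]) 0 := by
  have hl : HasDerivAt (fun t : ℝ => x + t • e) e 0 := by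
    simpa using ((hasDerivAt_id (0 : ℝ)).smul_const e).const_add x
  have hd : Differentiable ℝ (fderiv ℝ u) :=
    (hu.fderiv_right (m := 1) (by norm_num)).differentiable (by norm_num)
  have h : HasDerivAt (fun t : ℝ => fderiv ℝ u (x + t • e))
      (fderiv ℝ (fderiv ℝ u) (x + (0 : ℝ) • e) e) 0 :=
    (hd (x + (0 : ℝ) • e)).hasFDerivAt.comp_hasDerivAt 0 hl
  rw [zero_smul, add_zero] at h
  rw [iteratedFDeriv_two_apply]
  exact (ContinuousLinearMap.apply ℝ ℝ e).hasFDerivAt.comp_hasDerivAt 0 h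

/-- First and second order conditions along a line at a point where `u - φ` has a local minimum. -/
theorem line_conditions_of_isLocalMin (hu : ContDiff ℝ 2 u) {M c : ℝ} {φ : E → ℝ} {x e : E}
    {p' : ℝ → ℝ} (hmin : IsLocalMin (fun y => M * u y - φ y) x)
    (hp : ∀ t, HasDerivAt (fun t : ℝ => φ (x + t • e)) (p' t) t) (hp' : HasDerivAt p' c 0) :
    M * fderiv ℝ u x e = p' 0 ∧ c ≤ M * iteratedFDeriv ℝ 2 u x ![e, e] := by
  have hline : IsLocalMin (fun t : ℝ => M * u (x + t • e) - φ (x + t • e)) 0 := by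
    have hl : ContinuousAt (fun t : ℝ => x + t • e) 0 := by fun_prop
    have hx : x + (0 : ℝ) • e = x := by simp
    have := hl.tendsto.eventually (by rw [hx]; exact hmin)
    simpa [IsLocalMin, IsMinFilter] using this
  have h1 : ∀ t, HasDerivAt (fun t : ℝ => M * u (x + t • e) - φ (x + t • e))
      (M * fderiv ℝ u (x + t • e) e - p' t) t := fun t =>
    ((hasDerivAt_comp_line hu x e t).const_mul M).sub (hp t)
  have h2 := ((hasDerivAt_fderiv_comp_line hu x e).const_mul M).sub hp'
  have h3 := nonneg_second_deriv_of_isLocalMin hline h1 h2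
  have h4 := hline.hasDerivAt_eq_zero (h1 0)
  simp only [zero_smul, add_zero] at h4
  exact ⟨by linarith, by linarith⟩

end Line

/-- A bump, exponentially tilted in the direction of the `m`-th coordinate, that vanishes on the
sphere of squared radius `S`. -/
noncomputable def tiltedBump {n : ℕ} (m : Fin n) (η S : ℝ) (y : EuclideanSpace ℝ (Fin n)) : ℝ :=
  Real.exp (η / 2 * y m) * (S - ‖y‖ ^ 2) ^ 2

section Bump

variable {n : ℕ} {m : Fin n} {η S : ℝ}

theorem continuous_tiltedBump : Continuous (tiltedBump m η S) := by
  unfold tiltedBump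
  fun_prop

theorem tiltedBump_line (y : EuclideanSpace ℝ (Fin n)) (i : Fin n) (t : ℝ) :
    tiltedBump m η S (y + t • EuclideanSpace.single i (1 : ℝ)) =
      Real.exp (η / 2 * (y m + t * if m = i then 1 else 0)) *
        (S - ‖y‖ ^ 2 - 2 * t * y i - t ^ 2) ^ 2 := by
  have h : ‖y + t • EuclideanSpace.single i (1 : ℝ)‖ ^ 2 = ‖y‖ ^ 2 + 2 * t * y i + t ^ 2 := by
    rw [norm_add_sq_real, norm_smul, inner_smul_right, EuclideanSpace.inner_single_right]
    simp
    ring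
  rw [tiltedBump, h]
  congr 1
  · simp [PiLp.single_apply]
  · ring

/-- Applied with `s = S - ‖y‖²`, `r = y i`, and `d` equal to `1` along the tilt and `0` along the
other axes. -/
theorem tilted_quartic_derivs (η y d s r : ℝ) :
    (∀ t, HasDerivAt (fun t : ℝ => Real.exp (η / 2 * (y + t * d)) * (s - 2 * t * r - t ^ 2) ^ 2)
      (Real.exp (η / 2 * (y + t * d)) * (η / 2 * d * (s - 2 * t * r - t ^ 2) ^ 2
        + 2 * (s - 2 * t * r - t ^ 2) * (-2 * r - 2 * t))) t) ∧
    HasDerivAt (fun t : ℝ => Real.exp (η / 2 * (y + t * d)) *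
        (η / 2 * d * (s - 2 * t * r - t ^ 2) ^ 2
          + 2 * (s - 2 * t * r - t ^ 2) * (-2 * r - 2 * t)))
      (Real.exp (η / 2 * y) *
        (η ^ 2 / 4 * d ^ 2 * s ^ 2 - 4 * η * d * s * r + 8 * r ^ 2 - 4 * s)) 0 := by
  have hE : ∀ t : ℝ, HasDerivAt (fun t : ℝ => Real.exp (η / 2 * (y + t * d)))
      (Real.exp (η / 2 * (y + t * d)) * (η / 2 * d)) t := fun t => by
    have := ((((hasDerivAt_id t).mul_const d).const_add y).const_mul (η / 2)).exp
    simpa using this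
  have hq : ∀ t : ℝ, HasDerivAt (fun t : ℝ => s - 2 * t * r - t ^ 2) (-2 * r - 2 * t) t :=
    fun t => by
      refine (((((hasDerivAt_id t).const_mul 2).mul_const r).const_sub s).sub
        ((hasDerivAt_id t).pow 2)).congr_deriv ?_
      simp
  have hl : ∀ t : ℝ, HasDerivAt (fun t : ℝ => -2 * r - 2 * t) (-2) t := fun t => by
    simpa using ((hasDerivAt_id t).const_mul 2).const_sub (-2 * r)
  constructor
  · intro t
    refine ((hE t).mul ((hq t).pow 2)).congr_deriv ?_
    simp only [Pi.pow_apply]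
    push_cast
    ring
  · refine ((hE 0).mul ((((hq 0).pow 2).const_mul (η / 2 * d)).add
      (((hq 0).const_mul 2).mul (hl 0)))).congr_deriv ?_
    simp
    ring

end Bump

/-- At an interior point where `M * u` touches a translated bump from above, a solution of
`Δ u - η ∂ₘ u + a u - b u³ = 0` obeys the differential inequality of the bump. -/
theorem bump_inequality_of_touching {n : ℕ} {m : Fin n} {a b η S M : ℝ}
    {u : EuclideanSpace ℝ (Fin n) → ℝ} (hu : ContDiff ℝ 2 u) {x z : EuclideanSpace ℝ (Fin n)}
    (heq : Laplacian.laplacian u x - η * fderiv ℝ u x (EuclideanSpace.single m 1)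
      + a * u x - b * u x ^ 3 = 0)
    (hmin : IsLocalMin (fun y => M * u y - tiltedBump m η S (y - z)) x)
    (htouch : M * u x = tiltedBump m η S (x - z)) :
    8 * S - (4 * n + 8) * (S - ‖x - z‖ ^ 2) + (a - η ^ 2 / 4) * (S - ‖x - z‖ ^ 2) ^ 2
      ≤ b * u x ^ 2 * (S - ‖x - z‖ ^ 2) ^ 2 := by
  set s := S - ‖x - z‖ ^ 2 with hs
  set y := x - z with hy
  have key : ∀ i : Fin n, M * fderiv ℝ u x (EuclideanSpace.single i 1) =
        Real.exp (η / 2 * y m) * (η / 2 * (if m = i then 1 else 0) * s ^ 2 - 4 * s * y i) ∧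
      Real.exp (η / 2 * y m) * (η ^ 2 / 4 * (if m = i then 1 else 0) ^ 2 * s ^ 2
        - 4 * η * (if m = i then 1 else 0) * s * y i + 8 * y i ^ 2 - 4 * s) ≤
      M * iteratedFDeriv ℝ 2 u x ![EuclideanSpace.single i 1, EuclideanSpace.single i 1] := by
    intro i
    obtain ⟨h1, h2⟩ := tilted_quartic_derivs η (y m) (if m = i then 1 else 0) s (y i)
    obtain ⟨h3, h4⟩ := line_conditions_of_isLocalMin hu (e := EuclideanSpace.single i 1) hmin
      (fun t => by
        have h5 := h1 t
        simp_rw [hs, ← tiltedBump_line, hy] at h5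
        simp_rw [add_sub_right_comm]
        exact h5) h2
    refine ⟨?_, h4⟩
    rw [h3]
    simp
    ring
  have hsum : Real.exp (η / 2 * y m) * (η ^ 2 / 4 * s ^ 2 - 4 * η * s * y m + 8 * ‖y‖ ^ 2
      - 4 * n * s) ≤ M * Laplacian.laplacian u x := by
    rw [InnerProductSpace.laplacian_eq_iteratedFDeriv_orthonormalBasis u
      (EuclideanSpace.basisFun (Fin n) ℝ)]
    simp only [EuclideanSpace.basisFun_apply]
    rw [Finset.mul_sum]
    refine le_trans (le_of_eq ?_) (Finset.sum_le_sum fun i _ => (key i).2)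
    rw [← Finset.mul_sum, EuclideanSpace.real_norm_sq_eq]
    congr 1
    simp [Finset.sum_add_distrib, Finset.sum_sub_distrib, Finset.mul_sum, mul_assoc]
    ring
  have hgrad := (key m).1
  rw [if_pos rfl] at hgrad
  rw [tiltedBump, ← hs] at htouch
  have hE := Real.exp_pos (η / 2 * y m)
  set A := Real.exp (η / 2 * y m)
  refine le_of_mul_le_mul_left ?_ hE
  have hy2 : ‖y‖ ^ 2 = S - s := by rw [hs]; ring
  rw [hy2] at hsum
  -- Once this is inserted, the `η * s * y m` terms of the Laplacian and the drift cancel, and the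
  -- `η²` terms combine to `-η² / 4`.
  have h5 : M * Laplacian.laplacian u x = η * (A * (η / 2 * 1 * s ^ 2 - 4 * s * y m))
      - a * (A * s ^ 2) + b * u x ^ 2 * (A * s ^ 2) := by
    rw [← hgrad, ← htouch]
    linear_combination M * heq
  rw [h5] at hsum
  linarith

open Metric in
/-- Positive entire solutions of `Δ u - η ∂ₘ u + a u - b u³ = 0` with `η² < 4 a` are bounded below
by a positive constant. -/
theorem exists_pos_le_of_speed_lt {n : ℕ} {m : Fin n} {a b η : ℝ} (hb : 0 < b)
    (hη : η ^ 2 < 4 * a) {u : EuclideanSpace ℝ (Fin n) → ℝ} (hu : ContDiff ℝ 2 u)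
    (hpos : ∀ x, 0 < u x)
    (heq : ∀ x, Laplacian.laplacian u x - η * fderiv ℝ u x (EuclideanSpace.single m 1)
      + a * u x - b * u x ^ 3 = 0) :
    ∃ δ > 0, ∀ z, δ ≤ u z := by
  obtain ⟨c, hc, hca⟩ : ∃ c > 0, a - η ^ 2 / 4 = 2 * c :=
    ⟨(a - η ^ 2 / 4) / 2, by linarith, by ring⟩
  -- This radius makes the discriminant of `8R² - (4n + 8)s + cs²` vanish. Only half of `a - η² / 4
  -- = 2c` is spent here; the other half bounds `u x` below.
  obtain ⟨R, hR, hRc⟩ : ∃ R > 0, (4 * (n : ℝ) + 8) ^ 2 = 32 * c * R ^ 2 := by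
    refine ⟨(4 * (n : ℝ) + 8) / √(32 * c), by positivity, ?_⟩
    rw [div_pow, Real.sq_sqrt (by positivity)]
    field_simp
  set φ := tiltedBump m η (R ^ 2) with hφ
  have hφc : Continuous φ := continuous_tiltedBump
  have hφ0 : 0 < φ 0 := by simp [hφ, tiltedBump]; positivity
  obtain ⟨K, hK⟩ := (isCompact_closedBall (0 : EuclideanSpace ℝ (Fin n)) R).bddAbove_image
    hφc.continuousOn
  have hK' : ∀ y, ‖y‖ ≤ R → φ y ≤ K := fun y hy =>
    hK ⟨y, by simpa using hy, rfl⟩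
  have hKpos : 0 < K := hφ0.trans_le (hK' 0 (by simpa using hR.le))
  refine ⟨φ 0 * √(c / b) / K, by positivity, fun z => ?_⟩
  -- The maximal ratio is the least `M` with `M * u` above the bump on the ball.
  obtain ⟨x, hxR, hx⟩ := (isCompact_closedBall z R).exists_isMaxOn
    ⟨z, mem_closedBall_self hR.le⟩ (f := fun x => φ (x - z) / u x)
    ((hφc.comp (continuous_id.sub continuous_const)).div hu.continuous
      fun x => (hpos x).ne').continuousOn
  set M := φ (x - z) / u x with hM
  have hle : ∀ y ∈ closedBall z R, φ (y - z) ≤ M * u y := fun y hy =>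
    (div_le_iff₀ (hpos y)).1 (hx hy)
  have htouch : M * u x = φ (x - z) := div_mul_cancel₀ _ (hpos x).ne'
  have hz : φ 0 ≤ M * u z := by simpa using hle z (mem_closedBall_self hR.le)
  have hMpos : 0 < M := pos_of_mul_pos_left (hφ0.trans_le hz) (hpos z).le
  have hφx : 0 < φ (x - z) := htouch ▸ mul_pos hMpos (hpos x)
  rw [mem_closedBall, dist_eq_norm] at hxR
  -- The bump vanishes on the sphere, so the contact point is interior.
  have hne : R ^ 2 - ‖x - z‖ ^ 2 ≠ 0 := fun h => by simp [hφ, tiltedBump, h] at hφx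
  have hxlt : ‖x - z‖ < R := lt_of_le_of_ne hxR fun h => hne (by rw [h]; ring)
  have hmin : IsLocalMin (fun y => M * u y - φ (y - z)) x := by
    filter_upwards [closedBall_mem_nhds_of_mem (x := x) (c := z) (ε := R)
      (by rwa [mem_ball, dist_eq_norm])] with y hy
    have := hle y hy
    linarith
  have hineq := bump_inequality_of_touching hu (heq x) hmin htouch
  rw [hca] at hineq
  set s := R ^ 2 - ‖x - z‖ ^ 2
  have hquad : 0 ≤ 8 * R ^ 2 - (4 * n + 8) * s + c * s ^ 2 := by
    have : 0 ≤ 4 * c * (8 * R ^ 2 - (4 * n + 8) * s + c * s ^ 2) := by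
      have := sq_nonneg (2 * c * s - (4 * n + 8))
      linarith
    exact nonneg_of_mul_nonneg_right this (by positivity)
  have hcb : c ≤ b * u x ^ 2 := by
    refine le_of_mul_le_mul_right ?_ (by positivity : 0 < s ^ 2)
    linarith
  have hux : √(c / b) ≤ u x := by
    rw [Real.sqrt_le_left (hpos x).le, div_le_iff₀ hb]
    linarith
  rw [div_le_iff₀ hKpos]
  calc φ 0 * √(c / b) ≤ M * u z * u x := by
        have := (mul_pos hMpos (hpos z)).le
        gcongr
    _ = u z * φ (x - z) := by rw [← htouch]; ring
    _ ≤ u z * K := mul_le_mul_of_nonneg_left (hK' _ hxR) (hpos z).le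

/-- The profile of a travelling wave solution of the Newell-Whitehead equation is `C²` and solves
the elliptic profile equation. -/
theorem IsNewellWhiteheadSolution.profile {n : ℕ} {hn : 1 ≤ n} {a b η : ℝ}
    {v : EuclideanSpace ℝ (Fin n) → ℝ} {f : EuclideanSpace ℝ (Fin n) → ℝ → ℝ}
    (hsol : IsNewellWhiteheadSolution a b f) (hwave : HasTravelingWaveForm hn η v f) :
    ContDiff ℝ 2 v ∧ ∀ x, Laplacian.laplacian v x
      - η * fderiv ℝ v x (EuclideanSpace.single (lastIndex n hn) 1) + a * v x - b * v x ^ 3 = 0 := by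
  set e : EuclideanSpace ℝ (Fin n) := EuclideanSpace.single (lastIndex n hn) 1 with he
  have hsingle : ∀ r : ℝ, EuclideanSpace.single (lastIndex n hn) r = r • e := fun r => by
    ext i
    simp [he, PiLp.single_apply]
  have hf1 : (fun y => f y 1) = fun y => v (y + η • e) := by
    funext y
    rw [hwave y 1 zero_le_one, hsingle, mul_one]
  have hv : ContDiff ℝ 2 v := by
    have h := (hsol.contDiff_space 1 one_pos).comp (contDiff_id.sub (contDiff_const (c := η • e)))
    rw [hf1] at h
    simpa [Function.comp_def] using h
  refine ⟨hv, fun x => ?_⟩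
  have h1 := hsol.equation (x - η • e) 1 one_pos
  have hlap : Laplacian.laplacian (fun y => f y 1) (x - η • e) = Laplacian.laplacian v x := by
    rw [hf1]
    simp [InnerProductSpace.laplacian_eq_iteratedFDeriv_stdOrthonormalBasis,
      iteratedFDeriv_comp_add_right]
  have hval : f (x - η • e) 1 = v x := by simpa using congrFun hf1 (x - η • e)
  rw [hlap, hval] at h1
  have h2 : HasDerivAt (fun s => f (x - η • e) s) (fderiv ℝ v x (η • e)) 1 := by
    have h3 := hasDerivAt_comp_line hv (x - η • e) (η • e) 1
    rw [one_smul, sub_add_cancel] at h3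
    refine h3.congr_of_eventuallyEq ?_
    filter_upwards [lt_mem_nhds one_pos] with s hs
    rw [hwave _ s (le_of_lt hs), hsingle, mul_comm, mul_smul]
  have h4 := h1.unique h2
  rw [map_smul, smul_eq_mul] at h4
  linarith

theorem corollary4p2 (n : ℕ) (hn : 1 ≤ n) (a b : ℝ) (ha : 0 < a) (hb : 0 < b) (η : ℝ)
    (v : EuclideanSpace ℝ (Fin n) → ℝ) (f : EuclideanSpace ℝ (Fin n) → ℝ → ℝ)
    (hsol : IsNewellWhiteheadSolution a b f)
    (hpos : ∀ (x : EuclideanSpace ℝ (Fin n)) (t : ℝ), 0 ≤ t → 0 < f x t)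
    (hwave : HasTravelingWaveForm hn η v f)
    (hdecay : ∃ z : ℕ → EuclideanSpace ℝ (Fin n),
      Tendsto (fun k => ‖z k‖) atTop atTop ∧ Tendsto (fun k => v (z k)) atTop (𝓝 0)) :
    4 / 3 * a ≤ η ^ 2 := by
  by_contra! hlt
  obtain ⟨hv, heq⟩ := hsol.profile hwave
  have hvpos : ∀ x, 0 < v x := fun x => by
    have h := hpos x 0 le_rfl
    rw [hwave x 0 le_rfl] at h
    simpa [show EuclideanSpace.single (lastIndex n hn) (0 : ℝ) = 0 by ext i; simp] using h
  -- There is room to spare: `η² < 4a` would suffice.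
  obtain ⟨δ, hδ, hle⟩ := exists_pos_le_of_speed_lt hb (by linarith) hv hvpos heq
  obtain ⟨z, -, hz⟩ := hdecay
  exact hδ.not_ge (ge_of_tendsto' hz fun k => hle (z k))
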